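/- Let $l\ge 1$, $s^{(1)},\dots,s^{(l)}\ge 1$, $s=\sum_j s^{(j)}$, and let $\mathcal S$ be the space of real symmetric block diagonal $s\times s$ matrices $\mathrm{diag}(X_1,\dots,X_l)$ with $X_j$ of size $s^{(j)}$, with $\langle A,B\rangle=\mathrm{trace}(B^TA)$. Let $C,A_1,\dots,A_m\in\mathcal S$, $b\in\mathbb R^m$, $\mathcal AX=(\langle A_i,X\rangle)_{i\le m}$, $\mathcal A^Tz=\sum_i z_iA_i$, and consider the primal and dual semidefinite programs $$-\tau=\sup_{X\in\mathcal S}\{\langle C,X\rangle:\mathcal AX=b,\ X\succeq 0\},\qquad -\rho=\inf_{z\in\mathbb R^m}\{b^Tz:\mathcal A^Tz-C\succeq 0\}.$$ Assume strong duality ($\tau=\rho\in\mathbb R$) and the constant trace property: there is $a>0$ such that every $X\in\mathcal S$ with $\mathcal AX=b$ has $\mathrm{trace}(X)=a$. Let $\varphi(z)=a\lambda_1(C-\mathcal A^Tz)+b^Tz$ for $z\in\mathbb R^m$, where $\lambda_1$ is the largest eigenvalue. Let (T) be an iterative method which is globally convergent for minimizing $\varphi$: from every starting point its iterates $z_k$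 satisfy $\varphi(z_k)\to\inf\varphi$ (in $[-\infty,\infty]$). Algorithm SDP-CTP: (1) compute the optimal value and a minimizer $\bar z$ of $\varphi$ by method (T); (2) compute the unit eigenvectors $u_j$ of $C-\mathcal A^T\bar z$ for its largest eigenvalue, each of them supported on a single block; (3) compute an optimal solution $\bar\xi$ of the quadratic program $$\min_\xi\ \tfrac12\Big\|b-a\mathcal A\Big(\sum_j\xi_ju_ju_j^T\Big)\Big\|_2^2\quad\text{s.t. }\sum_j\xi_j=1,\ \xi_j\ge 0$$ (with finitely supported $\xi$ if there are infinitely many $u_j$), and output the value from (1) and $X^\star=a\sum_j\bar\xi_ju_ju_j^T$. Then the output value is well defined and equals $-\tau$: $\inf\varphi=-\tau$, from every starting point the iterates of (T) satisfy $\varphi(z_k)\to-\tau$, and every cluster point of the iterates is a minimizer of $\varphi$. If moreover the dual program has an optimal solution, then a minimizer $\bar z$ of $\varphi$ exists, and for every minimizer $\bar z$ the output $X^\star$ is well defined, that is: (a) for every family $(u_j)$ listing, at least up to sign, all single-block unit eigenvectors of $C-\mathcal A^T\bar z$ for $\lambda_1(C-\mathcal A^T\bar z)$, the quadratic program has an optimal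 solution, and for each of its optimal solutions $X^\star$ is an optimal solution of the primal program, with $\langle C,X^\star\rangle=-\tau$; (b) for every finite nonempty family of such eigenvectors the quadratic program has an optimal solution, and there is a finite nonempty family $u_1,\dots,u_r$ of such eigenvectors for which every optimal solution of the quadratic program yields an $X^\star$ that is an optimal solution of the primal program, with $\langle C,X^\star\rangle=-\tau$. -/

import Mathlib

open scoped Matrix
open Filter Topology

noncomputable section

namespace SpectralSDP

/-- Row and column indices of an `l`-block matrix whose `j`-th block has size `sz j`. -/
abbrev Idx {l : ℕ} (sz : Fin l → ℕ) : Type := (j : Fin l) × Fin (sz j)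

/-- The space `𝒮` of real symmetric block diagonal matrices with blocks of sizes `sz j`. -/
def blockSym {l : ℕ} (sz : Fin l → ℕ) : Submodule ℝ (Matrix (Idx sz) (Idx sz) ℝ) where
  carrier := {X | X.IsSymm ∧ ∀ p q : Idx sz, p.1 ≠ q.1 → X p q = 0}
  add_mem' := by
    rintro X Y ⟨hX, hX'⟩ ⟨hY, hY'⟩
    exact ⟨hX.add hY, fun p q h => by simp [hX' p q h, hY' p q h]⟩
  zero_mem' := ⟨Matrix.isSymm_zero, fun _ _ _ => rfl⟩
  smul_mem' := by
    rintro c X ⟨hX, hX'⟩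
    exact ⟨hX.smul c, fun p q h => by simp [hX' p q h]⟩

/-- The scalar product `⟨A, B⟩ = trace (Bᵀ A)`. -/
def frob {n : Type} [Fintype n] (A B : Matrix n n ℝ) : ℝ := (Bᵀ * A).trace

/-- The largest eigenvalue `λ₁(M)`; the set is finite and nonempty when `M` is symmetric of
positive size. -/
def lambdaMax {n : Type} [Fintype n] [DecidableEq n] (M : Matrix n n ℝ) : ℝ :=
  sSup {μ : ℝ | Module.End.HasEigenvalue (Matrix.toLin' M) μ}

/-- The data of a block SDP with `m` equality constraints. -/
structure SDP {l : ℕ} (sz : Fin l → ℕ) (m : ℕ) where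
  A : Fin m → blockSym sz
  C : blockSym sz
  b : EuclideanSpace ℝ (Fin m)

namespace SDP

variable {l : ℕ} {sz : Fin l → ℕ} {m : ℕ} (P : SDP sz m)

/-- `𝒜 X = (⟨A₁, X⟩, …, ⟨A_m, X⟩)`. -/
def op (X : Matrix (Idx sz) (Idx sz) ℝ) : EuclideanSpace ℝ (Fin m) :=
  WithLp.toLp 2 fun i => frob (P.A i : Matrix (Idx sz) (Idx sz) ℝ) X

/-- `𝒜ᵀ z = ∑ i, z i • A i`. -/
def adj (z : EuclideanSpace ℝ (Fin m)) : Matrix (Idx sz) (Idx sz) ℝ :=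
  ∑ i, z i • (P.A i : Matrix (Idx sz) (Idx sz) ℝ)

/-- The linear form `bᵀ z`. -/
def lin (z : EuclideanSpace ℝ (Fin m)) : ℝ := ∑ i, P.b i * z i

/-- The primal feasible set `{X ∈ 𝒮 : 𝒜 X = b, X ⪰ 0}`. -/
def primalFeasible : Set (Matrix (Idx sz) (Idx sz) ℝ) :=
  {X | X ∈ blockSym sz ∧ P.op X = P.b ∧ X.PosSemidef}

/-- The dual feasible set `{z : 𝒜ᵀ z - C ⪰ 0}`. -/
def dualFeasible : Set (EuclideanSpace ℝ (Fin m)) :=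
  {z | (P.adj z - (P.C : Matrix (Idx sz) (Idx sz) ℝ)).PosSemidef}

/-- The primal optimal value, `sup ⟨C, X⟩` over the primal feasible set. -/
def primalValue : EReal := ⨆ X ∈ P.primalFeasible, ((frob (P.C : Matrix _ _ ℝ) X : ℝ) : EReal)

/-- The dual optimal value, `inf bᵀ z` over the dual feasible set. -/
def dualValue : EReal := ⨅ z ∈ P.dualFeasible, ((P.lin z : ℝ) : EReal)

/-- Strong duality: both values equal the same real number `-τ`. -/
def StrongDuality (τ : ℝ) : Prop :=
  P.primalValue = ((-τ : ℝ) : EReal) ∧ P.dualValue = ((-τ : ℝ) : EReal)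

/-- `X` is an optimal solution of the primal SDP. -/
def IsPrimalSolution (X : Matrix (Idx sz) (Idx sz) ℝ) : Prop :=
  X ∈ P.primalFeasible ∧
    ∀ Y ∈ P.primalFeasible, frob (P.C : Matrix _ _ ℝ) Y ≤ frob (P.C : Matrix _ _ ℝ) X

/-- Dual attainability: the dual SDP has an optimal solution. -/
def DualAttained : Prop :=
  ∃ z ∈ P.dualFeasible, ∀ w ∈ P.dualFeasible, P.lin z ≤ P.lin w

/-- The constant trace property with constant `a > 0`. -/
def CTP (a : ℝ) : Prop :=
  0 < a ∧ ∀ X ∈ blockSym sz, P.op X = P.b → X.trace = a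

/-- The spectral objective `φ(z) = a λ₁(C - 𝒜ᵀ z) + bᵀ z`. -/
def phi (a : ℝ) (z : EuclideanSpace ℝ (Fin m)) : ℝ :=
  a * lambdaMax ((P.C : Matrix _ _ ℝ) - P.adj z) + P.lin z

/-- The unit eigenvectors of `C - 𝒜ᵀ z` for its largest eigenvalue, computed block by block:
each is supported on one block (a unit eigenvector of that block, padded with zeros). -/
def topEigenvectors (z : EuclideanSpace ℝ (Fin m)) : Set (EuclideanSpace ℝ (Idx sz)) :=
  {u | ‖u‖ = 1 ∧
    ((P.C : Matrix _ _ ℝ) - P.adj z) *ᵥ u.ofLp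
      = lambdaMax ((P.C : Matrix _ _ ℝ) - P.adj z) • u.ofLp ∧
    ∃ j : Fin l, ∀ p : Idx sz, p.1 ≠ j → u p = 0}

/-- The family `u` lists all these eigenvectors, at least up to sign
(the matrices `u uᵀ` do not depend on the sign). -/
def ListsTopEigenvectors (z : EuclideanSpace ℝ (Fin m)) {ι : Type}
    (u : ι → EuclideanSpace ℝ (Idx sz)) : Prop :=
  (∀ i, u i ∈ P.topEigenvectors z) ∧
    ∀ v ∈ P.topEigenvectors z, ∃ i, u i = v ∨ u i = -v

end SDP

/-- `∑ j, ξ j • u j (u j)ᵀ` for finitely supported weights `ξ`. -/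
def rankOneSum {n ι : Type} (u : ι → EuclideanSpace ℝ n) (ξ : ι →₀ ℝ) : Matrix n n ℝ :=
  ξ.sum fun i t => t • Matrix.vecMulVec (u i).ofLp (u i).ofLp

namespace SDP

variable {l : ℕ} {sz : Fin l → ℕ} {m : ℕ} (P : SDP sz m)

/-- Objective `½ ‖b - a 𝒜 (∑ ξ_j u_j u_jᵀ)‖²` of the quadratic program. -/
def qpObjective (a : ℝ) {ι : Type} (u : ι → EuclideanSpace ℝ (Idx sz)) (ξ : ι →₀ ℝ) : ℝ :=
  1 / 2 * ‖P.b - a • P.op (rankOneSum u ξ)‖ ^ 2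

/-- `ξ` is an optimal solution of the quadratic program over the unit simplex on the family `u`.
The family may be infinite, in which case the weights have finite support. -/
def IsQPSolution (a : ℝ) {ι : Type} (u : ι → EuclideanSpace ℝ (Idx sz)) (ξ : ι →₀ ℝ) : Prop :=
  ((∀ i, 0 ≤ ξ i) ∧ (ξ.sum fun _ t => t) = 1) ∧
    ∀ η : ι →₀ ℝ, (∀ i, 0 ≤ η i) → (η.sum fun _ t => t) = 1 →
      P.qpObjective a u ξ ≤ P.qpObjective a u η

end SDP

/-- `z` is an optimal solution of the unconstrained problem of minimizing `f`. -/
def IsMinimizer {m : ℕ} (f : EuclideanSpace ℝ (Fin m) → ℝ)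
    (z : EuclideanSpace ℝ (Fin m)) : Prop := ∀ w, f z ≤ f w

/-- An iterative method for unconstrained nonsmooth optimization: to an objective and a starting
point it assigns the sequence of iterates (constant from some index on if the method stops). -/
abbrev Method : Type :=
  ∀ m : ℕ, (EuclideanSpace ℝ (Fin m) → ℝ) → EuclideanSpace ℝ (Fin m) →
    ℕ → EuclideanSpace ℝ (Fin m)

/-- The method is globally convergent on the problem of minimizing `f`: from every starting point
the objective values of the iterates converge to the optimal value `inf f` (in `[-∞, ∞]`). -/
def Method.GloballyConvergent (T : Method) {m : ℕ}
    (f : EuclideanSpace ℝ (Fin m) → ℝ) : Prop :=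
  ∀ z₀, Tendsto (fun k => ((f (T m f z₀ k) : ℝ) : EReal)) atTop (𝓝 (⨅ z, ((f z : ℝ) : EReal)))

end SpectralSDP

end

/-! Put `N(z) = λ₁ I - (C - 𝒜ᵀz)`, which is positive semidefinite. For `X` in `𝒮` with `𝒜X = b`,
constant trace gives `⟨N(z), X⟩ = φ(z) - ⟨C, X⟩` (`phi_sub_frob`). Hence `φ` dominates the primal
value; at dual feasible `z` also `λ₁ ≤ 0`, so `φ(z) ≤ bᵀz`, and strong duality pins `inf φ` at `-τ`.

Bounded trace makes the primal feasible set compact, so a primal solution `X` exists. At a minimizer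
`z` the gap `⟨N(z), X⟩` vanishes, which forces `X` to be `a` times a convex combination of
single-block top eigenprojections (`exists_weights_of_frob_eq_phi`). The quadratic program therefore
has value zero. Conversely, weights of objective zero give a feasible matrix with zero gap, hence a
primal solution (`IsQPSolution.mem_primalFeasible`). -/

namespace SpectralSDP

/-! ### The trace scalar product and the semidefinite cone. -/

section Frobenius

variable {n : Type} [Fintype n]

/-- The scalar product `frob` as a linear form in its second argument. -/
def frobLin (A : Matrix n n ℝ) : Matrix n n ℝ →ₗ[ℝ] ℝ where
  toFun B := frob A B
  map_add' B B' := by simp [frob, add_mul]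
  map_smul' c B := by simp [frob]

lemma frob_sub_left (A A' B : Matrix n n ℝ) : frob (A - A') B = frob A B - frob A' B := by
  simp [frob, mul_sub]

lemma frob_smul_left (c : ℝ) (A B : Matrix n n ℝ) : frob (c • A) B = c * frob A B := by
  simp [frob]

lemma frob_sum_left {ι : Type} (s : Finset ι) (A : ι → Matrix n n ℝ) (B : Matrix n n ℝ) :
    frob (∑ i ∈ s, A i) B = ∑ i ∈ s, frob (A i) B := by
  simp [frob, Finset.mul_sum, Matrix.trace_sum]

lemma frob_smul_right (c : ℝ) (A B : Matrix n n ℝ) : frob A (c • B) = c * frob A B :=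
  (frobLin A).map_smul c B

lemma frob_sum_right {ι : Type} (s : Finset ι) (A : Matrix n n ℝ) (B : ι → Matrix n n ℝ) :
    frob A (∑ i ∈ s, B i) = ∑ i ∈ s, frob A (B i) :=
  map_sum (frobLin A) B s

lemma frob_one_left [DecidableEq n] (B : Matrix n n ℝ) : frob 1 B = B.trace := by
  simp [frob, Matrix.trace_transpose]

lemma frob_vecMulVec (A : Matrix n n ℝ) (w : n → ℝ) :
    frob A (Matrix.vecMulVec w w) = w ⬝ᵥ A *ᵥ w := by
  rw [frob, Matrix.transpose_vecMulVec, Matrix.trace_mul_comm, Matrix.mul_vecMulVec,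
    Matrix.trace_vecMulVec, dotProduct_comm]

lemma continuous_frob (A : Matrix n n ℝ) : Continuous (frob A) := by
  unfold frob
  fun_prop

lemma posSemidef_vecMulVec (w : n → ℝ) : (Matrix.vecMulVec w w).PosSemidef := by
  simpa using Matrix.posSemidef_vecMulVec_self_star w

lemma isClosed_posSemidef : IsClosed {X : Matrix n n ℝ | X.PosSemidef} := by
  simp only [Matrix.posSemidef_iff_dotProduct_mulVec, Set.ofPred_and, Set.ofPred_forall]
  refine (isClosed_eq (by fun_prop) continuous_id).inter (isClosed_iInter fun x => ?_)
  exact isClosed_le continuous_const (by fun_prop)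

end Frobenius

/-! ### The largest eigenvalue. -/

section Eigenvalue

variable {n : Type} [Fintype n] [DecidableEq n] {M : Matrix n n ℝ}

lemma le_lambdaMax {μ : ℝ} {x : n → ℝ} (hx : x ≠ 0) (h : M *ᵥ x = μ • x) : μ ≤ lambdaMax M := by
  refine le_csSup (Module.End.finite_hasEigenvalue (Matrix.toLin' M)).bddAbove ?_
  exact Module.End.hasEigenvalue_of_hasEigenvector
    (Module.End.hasEigenvector_iff.2 ⟨Module.End.mem_eigenspace_iff.2 (by simpa using h), hx⟩)

lemma exists_mulVec_eq_lambdaMax [Nonempty n] (hM : M.IsHermitian) :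
    ∃ x : n → ℝ, x ⬝ᵥ x = 1 ∧ M *ᵥ x = lambdaMax M • x := by
  have hne : {μ : ℝ | Module.End.HasEigenvalue (Matrix.toLin' M) μ}.Nonempty := by
    obtain ⟨i⟩ := ‹Nonempty n›
    refine ⟨hM.eigenvalues i, Module.End.hasEigenvalue_of_hasEigenvector
      (x := (hM.eigenvectorBasis i).ofLp) (Module.End.hasEigenvector_iff.2
      ⟨Module.End.mem_eigenspace_iff.2 (by simpa using hM.mulVec_eigenvectorBasis i), ?_⟩)⟩
    intro h
    exact hM.eigenvectorBasis.toBasis.ne_zero i (by ext k; simpa using congrFun h k)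
  obtain ⟨x, hx⟩ := Module.End.HasEigenvalue.exists_hasEigenvector
    (hne.csSup_mem (Module.End.finite_hasEigenvalue (Matrix.toLin' M)))
  have hx0 : x ≠ 0 := hx.2
  have hxM : M *ᵥ x = lambdaMax M • x := by
    simpa only [Matrix.toLin'_apply, lambdaMax] using Module.End.mem_eigenspace_iff.1 hx.1
  have hpos : 0 < x ⬝ᵥ x := lt_of_le_of_ne
    (Finset.sum_nonneg fun i _ => mul_self_nonneg (x i))
    (fun h => hx0 (dotProduct_self_eq_zero.1 h.symm))
  refine ⟨(√(x ⬝ᵥ x))⁻¹ • x, ?_, ?_⟩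
  · rw [smul_dotProduct, dotProduct_smul, smul_eq_mul, smul_eq_mul, ← mul_assoc, ← mul_inv,
      Real.mul_self_sqrt hpos.le, inv_mul_cancel₀ hpos.ne']
  · rw [Matrix.mulVec_smul, hxM, smul_comm]

/-- An eigenvector of `λ₁ I - M` for `ν` is one of `M` for `λ₁ - ν`, and `λ₁ - ν ≤ λ₁` means `ν ≥
0`. -/
lemma posSemidef_lambdaMax_sub (hM : M.IsHermitian) : (lambdaMax M • 1 - M).PosSemidef := by
  have hN : (lambdaMax M • 1 - M).IsHermitian :=
    (Matrix.isHermitian_one.smul (IsSelfAdjoint.all _)).sub hM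
  refine hN.posSemidef_iff_eigenvalues_nonneg.2 fun i => ?_
  have h := hN.mulVec_eigenvectorBasis i
  have h0 : (hN.eigenvectorBasis i).ofLp ≠ 0 := fun h =>
    hN.eigenvectorBasis.toBasis.ne_zero i (by ext k; simpa using congrFun h k)
  have : lambdaMax M - hN.eigenvalues i ≤ lambdaMax M := by
    refine le_lambdaMax h0 ?_
    rw [sub_smul, ← h, Matrix.sub_mulVec, Matrix.smul_mulVec, Matrix.one_mulVec]
    abel
  simpa using this

lemma lambdaMax_nonpos [Nonempty n] (h : (-M).PosSemidef) : lambdaMax M ≤ 0 := by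
  have hM : M.IsHermitian := by simpa using h.1.neg
  obtain ⟨x, hx, hxM⟩ := exists_mulVec_eq_lambdaMax hM
  have := h.dotProduct_mulVec_nonneg x
  rw [star_trivial, Matrix.neg_mulVec, hxM, dotProduct_neg, dotProduct_smul, hx] at this
  simpa using this

end Eigenvalue

/-! ### Block diagonal semidefinite matrices. -/

section Blocks

variable {l : ℕ} {sz : Fin l → ℕ}

lemma isHermitian_of_mem_blockSym {X : Matrix (Idx sz) (Idx sz) ℝ} (hX : X ∈ blockSym sz) :
    X.IsHermitian := by
  rw [Matrix.IsHermitian, Matrix.conjTranspose_eq_transpose_of_trivial]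
  exact hX.1

lemma vecMulVec_mem_blockSym {w : Idx sz → ℝ} (hw : ∃ j : Fin l, ∀ p : Idx sz, p.1 ≠ j → w p = 0) :
    Matrix.vecMulVec w w ∈ blockSym sz := by
  obtain ⟨j, hj⟩ := hw
  refine ⟨Matrix.transpose_vecMulVec w w, fun p q hpq => ?_⟩
  by_cases hp : p.1 = j
  · simp [Matrix.vecMulVec_apply, hj q fun h => hpq (hp.trans h.symm)]
  · simp [Matrix.vecMulVec_apply, hj p hp]

/-- A positive semidefinite block diagonal matrix is a sum of rank one matrices, each of them
supported on one block. -/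
lemma exists_eq_sum_vecMulVec {X : Matrix (Idx sz) (Idx sz) ℝ} (hX : X ∈ blockSym sz)
    (hpos : X.PosSemidef) :
    ∃ (k : ℕ) (w : Fin l × Fin k → Idx sz → ℝ),
      (∀ i, ∃ j : Fin l, ∀ p : Idx sz, p.1 ≠ j → w i p = 0) ∧
      X = ∑ i, Matrix.vecMulVec (w i) (w i) := by
  obtain ⟨k, v, hv⟩ := Matrix.posSemidef_iff_eq_sum_vecMulVec.1 hpos
  -- Each vector of an arbitrary rank one decomposition is cut into its block pieces. The discarded
  -- cross terms only affect off-block entries, which vanish in `X`.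
  refine ⟨k, fun i p => if p.1 = i.1 then v i.2 p else 0, fun i => ⟨i.1, fun p hp => if_neg hp⟩, ?_⟩
  ext p q
  rw [Matrix.sum_apply, Fintype.sum_prod_type]
  by_cases hpq : p.1 = q.1
  · rw [Finset.sum_eq_single p.1 (fun j _ hj => by simp [Matrix.vecMulVec_apply, hj.symm])
      (by simp), hv, Matrix.sum_apply]
    simp [Matrix.vecMulVec_apply, hpq]
  · rw [hX.2 p q hpq]
    refine (Finset.sum_eq_zero fun j _ => Finset.sum_eq_zero fun i _ => ?_).symm
    by_cases hp : p.1 = j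
    · simp [Matrix.vecMulVec_apply, show q.1 ≠ j from fun h => hpq (hp.trans h.symm)]
    · simp [Matrix.vecMulVec_apply, hp]

lemma frob_nonneg {N X : Matrix (Idx sz) (Idx sz) ℝ} (hN : N.PosSemidef) (hX : X ∈ blockSym sz)
    (hpos : X.PosSemidef) : 0 ≤ frob N X := by
  obtain ⟨k, w, -, rfl⟩ := exists_eq_sum_vecMulVec hX hpos
  rw [frob_sum_right]
  refine Finset.sum_nonneg fun i _ => ?_
  rw [frob_vecMulVec]
  simpa using hN.dotProduct_mulVec_nonneg (w i)

lemma abs_apply_le_trace {n : Type} [Fintype n] [DecidableEq n] {X : Matrix n n ℝ}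
    (h : X.PosSemidef) (p q : n) : |X p q| ≤ X.trace := by
  have hd (i : n) : 0 ≤ X i i := h.diag_nonneg
  have hle (i : n) : X i i ≤ X.trace :=
    Finset.single_le_sum (f := fun i => X i i) (fun i _ => hd i) (Finset.mem_univ i)
  have hsymm : X q p = X p q := by simpa using h.1.apply p q
  -- Testing on `e_p ± e_q` gives `2|X p q| ≤ X p p + X q q`.
  have h1 := h.dotProduct_mulVec_nonneg (Pi.single p 1 + Pi.single q 1)
  have h2 := h.dotProduct_mulVec_nonneg (Pi.single p 1 - Pi.single q 1)
  simp [Matrix.mulVec_add, Matrix.mulVec_sub, hsymm] at h1 h2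
  have := hle p
  have := hle q
  rw [abs_le]
  constructor <;> linarith

end Blocks

lemma rankOneSum_eq_sum {n ι : Type} [Fintype ι] (u : ι → EuclideanSpace ℝ n) (ξ : ι →₀ ℝ) :
    rankOneSum u ξ = ∑ i, ξ i • Matrix.vecMulVec (u i).ofLp (u i).ofLp :=
  Finsupp.sum_fintype _ _ (by simp)

/-! ### The gap identity, the infimum of `φ` and cluster points. -/

namespace SDP

variable {l : ℕ} {sz : Fin l → ℕ} {m : ℕ} (P : SDP sz m)

lemma adj_mem (z : EuclideanSpace ℝ (Fin m)) : P.adj z ∈ blockSym sz :=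
  Submodule.sum_mem _ fun i _ => Submodule.smul_mem _ _ (P.A i).2

lemma isHermitian_sub_adj (z : EuclideanSpace ℝ (Fin m)) :
    ((P.C : Matrix (Idx sz) (Idx sz) ℝ) - P.adj z).IsHermitian :=
  isHermitian_of_mem_blockSym (Submodule.sub_mem _ P.C.2 (P.adj_mem z))

lemma op_smul (c : ℝ) (X : Matrix (Idx sz) (Idx sz) ℝ) : P.op (c • X) = c • P.op X := by
  ext i
  simp [op, frob_smul_right]

lemma frob_adj (z : EuclideanSpace ℝ (Fin m)) {X : Matrix (Idx sz) (Idx sz) ℝ}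
    (hX : P.op X = P.b) : frob (P.adj z) X = P.lin z := by
  rw [adj, frob_sum_left, lin, ← hX]
  exact Finset.sum_congr rfl fun i _ => by rw [frob_smul_left, mul_comm]; rfl

lemma continuous_op : Continuous P.op :=
  (PiLp.continuous_toLp 2 _).comp (continuous_pi fun _ => continuous_frob _)

/-- The gap between the spectral objective and the primal objective. -/
lemma phi_sub_frob {a : ℝ} (hctp : P.CTP a) (z : EuclideanSpace ℝ (Fin m))
    {X : Matrix (Idx sz) (Idx sz) ℝ} (hX : X ∈ blockSym sz) (hXb : P.op X = P.b) :
    frob (lambdaMax ((P.C : Matrix (Idx sz) (Idx sz) ℝ) - P.adj z) • 1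
      - ((P.C : Matrix (Idx sz) (Idx sz) ℝ) - P.adj z)) X
      = P.phi a z - frob (P.C : Matrix (Idx sz) (Idx sz) ℝ) X := by
  rw [frob_sub_left, frob_sub_left, frob_smul_left, frob_one_left, hctp.2 X hX hXb,
    P.frob_adj z hXb, phi]
  ring

lemma frob_le_phi {a : ℝ} (hctp : P.CTP a) (z : EuclideanSpace ℝ (Fin m))
    {X : Matrix (Idx sz) (Idx sz) ℝ} (hX : X ∈ P.primalFeasible) :
    frob (P.C : Matrix (Idx sz) (Idx sz) ℝ) X ≤ P.phi a z := by
  have := frob_nonneg (posSemidef_lambdaMax_sub (P.isHermitian_sub_adj z)) hX.1 hX.2.2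
  rw [P.phi_sub_frob hctp z hX.1 hX.2.1] at this
  linarith

lemma phi_le_lin [Nonempty (Idx sz)] {a : ℝ} (ha : 0 < a) {z : EuclideanSpace ℝ (Fin m)}
    (hz : z ∈ P.dualFeasible) : P.phi a z ≤ P.lin z := by
  have h : lambdaMax ((P.C : Matrix (Idx sz) (Idx sz) ℝ) - P.adj z) ≤ 0 :=
    lambdaMax_nonpos (by rw [neg_sub]; exact hz)
  have := mul_nonpos_of_nonneg_of_nonpos ha.le h
  rw [phi]
  linarith

variable {P} in
lemma StrongDuality.neg_le_phi {τ a : ℝ} (hdual : P.StrongDuality τ) (hctp : P.CTP a)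
    (z : EuclideanSpace ℝ (Fin m)) : -τ ≤ P.phi a z := by
  rw [← EReal.coe_le_coe_iff, ← hdual.1, primalValue]
  exact iSup₂_le fun X hX => EReal.coe_le_coe_iff.2 (P.frob_le_phi hctp z hX)

variable {P} in
lemma StrongDuality.isGLB_range_phi [Nonempty (Idx sz)] {τ a : ℝ} (hdual : P.StrongDuality τ)
    (hctp : P.CTP a) : IsGLB (Set.range (P.phi a)) (-τ) := by
  refine ⟨?_, fun c hc => ?_⟩
  · rintro _ ⟨z, rfl⟩
    exact hdual.neg_le_phi hctp z
  · rw [← EReal.coe_le_coe_iff, ← hdual.2, dualValue]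
    exact le_iInf₂ fun z hz =>
      EReal.coe_le_coe_iff.2 ((hc ⟨z, rfl⟩).trans (P.phi_le_lin hctp.1 hz))

/-- Only lower semicontinuity of `φ` at `z` is needed. Freezing a top unit eigenvector of `C - 𝒜ᵀz`
in the Rayleigh quotient supplies it, without continuity of `λ₁`. -/
lemma isMinimizer_of_mapClusterPt [Nonempty (Idx sz)] {a c : ℝ} (ha : 0 < a)
    (hc : ∀ z, c ≤ P.phi a z) {x : ℕ → EuclideanSpace ℝ (Fin m)}
    (hx : Tendsto (fun k => P.phi a (x k)) atTop (𝓝 c)) {z : EuclideanSpace ℝ (Fin m)}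
    (hz : MapClusterPt z atTop x) : IsMinimizer (P.phi a) z := by
  obtain ⟨y, hy, hyz⟩ := exists_mulVec_eq_lambdaMax (P.isHermitian_sub_adj z)
  -- an affine minorant of `φ` that is exact at `z`
  let g : EuclideanSpace ℝ (Fin m) → ℝ := fun w =>
    a * (y ⬝ᵥ ((P.C : Matrix (Idx sz) (Idx sz) ℝ) - P.adj w) *ᵥ y) + P.lin w
  have hg : Continuous g := by
    unfold g adj lin
    fun_prop
  have hgz : g z = P.phi a z := by
    simp only [g, phi, hyz, dotProduct_smul, hy, smul_eq_mul, mul_one]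
  have hgle (w) : g w ≤ P.phi a w := by
    have := (posSemidef_lambdaMax_sub (P.isHermitian_sub_adj w)).dotProduct_mulVec_nonneg y
    rw [star_trivial, Matrix.sub_mulVec, Matrix.smul_mulVec, Matrix.one_mulVec, dotProduct_sub,
      dotProduct_smul, hy, smul_eq_mul, mul_one, sub_nonneg] at this
    exact add_le_add_left (mul_le_mul_of_nonneg_left this ha.le) _
  -- Along an ultrafilter the iterates converge to `z`, which replaces extracting a subsequence.
  obtain ⟨U, hU, hUz⟩ := mapClusterPt_iff_ultrafilter.1 hz
  have hle : g z ≤ c := le_of_tendsto_of_tendsto ((hg.tendsto z).comp hUz) (hx.mono_left hU)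
    (Eventually.of_forall fun k => hgle (x k))
  exact fun w => (hgz ▸ hle).trans (hc w)

/-! ### Primal attainment and complementary slackness. -/

lemma isCompact_primalFeasible {a : ℝ} (hctp : P.CTP a) : IsCompact P.primalFeasible := by
  have hK : IsCompact (Set.pi Set.univ fun _ : Idx sz =>
      Set.pi Set.univ fun _ : Idx sz => Set.Icc (-a) a) :=
    isCompact_univ_pi fun _ => isCompact_univ_pi fun _ => isCompact_Icc
  refine IsCompact.of_isClosed_subset (t := P.primalFeasible) hK ?_ fun X hX p _ q _ => ?_
  · have h1 : IsClosed {X : Matrix (Idx sz) (Idx sz) ℝ | X ∈ blockSym sz} := by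
      change IsClosed {X : Matrix (Idx sz) (Idx sz) ℝ |
        Xᵀ = X ∧ ∀ p q : Idx sz, p.1 ≠ q.1 → X p q = 0}
      simp only [Set.ofPred_and, Set.ofPred_forall]
      refine (isClosed_eq (by fun_prop) continuous_id).inter (isClosed_iInter fun p =>
        isClosed_iInter fun q => isClosed_iInter fun _ => isClosed_eq (by fun_prop) ?_)
      exact continuous_const
    exact h1.inter ((isClosed_eq P.continuous_op continuous_const).inter isClosed_posSemidef)
  · have := abs_apply_le_trace hX.2.2 p q
    rw [hctp.2 X hX.1 hX.2.1] at this
    exact abs_le.1 this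

variable {P} in
lemma StrongDuality.frob_le {τ : ℝ} (hdual : P.StrongDuality τ)
    {X : Matrix (Idx sz) (Idx sz) ℝ} (hX : X ∈ P.primalFeasible) :
    frob (P.C : Matrix (Idx sz) (Idx sz) ℝ) X ≤ -τ := by
  rw [← EReal.coe_le_coe_iff, ← hdual.1, primalValue]
  exact le_iSup₂ (f := fun X (_ : X ∈ P.primalFeasible) =>
    ((frob (P.C : Matrix (Idx sz) (Idx sz) ℝ) X : ℝ) : EReal)) X hX

variable {P} in
lemma StrongDuality.exists_primal_solution {τ a : ℝ} (hdual : P.StrongDuality τ)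
    (hctp : P.CTP a) :
    ∃ X ∈ P.primalFeasible, frob (P.C : Matrix (Idx sz) (Idx sz) ℝ) X = -τ := by
  -- An empty feasible set would have supremum `⊥`, which is not the real number `-τ`.
  have hne : P.primalFeasible.Nonempty := by
    by_contra h
    have h1 := hdual.1
    rw [Set.not_nonempty_iff_eq_empty] at h
    refine EReal.coe_ne_bot (-τ) (h1.symm.trans ?_)
    simp [primalValue, h]
  obtain ⟨X, hX, hmax⟩ := (P.isCompact_primalFeasible hctp).exists_isMaxOn hne
    (continuous_frob (P.C : Matrix (Idx sz) (Idx sz) ℝ)).continuousOn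
  refine ⟨X, hX, le_antisymm (hdual.frob_le hX) ?_⟩
  rw [← EReal.coe_le_coe_iff, ← hdual.1, primalValue]
  exact iSup₂_le fun Y hY => EReal.coe_le_coe_iff.2 (hmax hY)

lemma exists_weights_of_frob_eq_phi {a : ℝ} (hctp : P.CTP a) {z : EuclideanSpace ℝ (Fin m)}
    {X : Matrix (Idx sz) (Idx sz) ℝ} (hX : X ∈ P.primalFeasible)
    (hXz : frob (P.C : Matrix (Idx sz) (Idx sz) ℝ) X = P.phi a z) :
    ∃ (r : ℕ) (v : Fin r → EuclideanSpace ℝ (Idx sz)) (ξ : Fin r →₀ ℝ),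
      (∀ j, v j ∈ P.topEigenvectors z) ∧ (∀ j, 0 ≤ ξ j) ∧ (ξ.sum fun _ t => t) = 1 ∧
      a • rankOneSum v ξ = X := by
  obtain ⟨k, w, hw, hsum⟩ := exists_eq_sum_vecMulVec hX.1 hX.2.2
  have ha := hctp.1
  have hN := posSemidef_lambdaMax_sub (P.isHermitian_sub_adj z)
  -- Complementary slackness: the nonnegative terms `wᵢᵀ N wᵢ` sum to the zero gap, so each
  -- vanishes, and semidefiniteness of `N` gives `N wᵢ = 0`.
  have hNw (i) : ((P.C : Matrix (Idx sz) (Idx sz) ℝ) - P.adj z) *ᵥ w i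
      = lambdaMax ((P.C : Matrix (Idx sz) (Idx sz) ℝ) - P.adj z) • w i := by
    have h0 := P.phi_sub_frob hctp z hX.1 hX.2.1
    rw [hXz, sub_self, hsum, frob_sum_right] at h0
    simp only [frob_vecMulVec] at h0
    have hi := (Finset.sum_eq_zero_iff_of_nonneg fun i _ => by
      simpa using hN.dotProduct_mulVec_nonneg (w i)).1 h0 i (Finset.mem_univ i)
    have := (hN.dotProduct_mulVec_zero_iff (w i)).1 (by simpa using hi)
    rw [Matrix.sub_mulVec, Matrix.smul_mulVec, Matrix.one_mulVec, sub_eq_zero] at this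
    exact this.symm
  -- Zero vectors are dropped because the others have to be normalized.
  let κ := {i : Fin l × Fin k // w i ≠ 0}
  let e : κ ≃ Fin (Fintype.card κ) := Fintype.equivFin κ
  let x : κ → EuclideanSpace ℝ (Idx sz) := fun i => WithLp.toLp 2 (w i)
  have hx (i : κ) : ‖x i‖ ≠ 0 := by
    rw [norm_ne_zero_iff]
    exact fun h => i.2 (by simpa [x] using h)
  have hxsq (i : κ) : ‖x i‖ ^ 2 = w i ⬝ᵥ w i := by
    rw [EuclideanSpace.real_norm_sq_eq, dotProduct]
    exact Finset.sum_congr rfl fun p _ => pow_two _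
  have hXκ : X = ∑ i : κ, Matrix.vecMulVec (w i) (w i) := by
    rw [hsum, ← Finset.sum_filter_of_ne (p := fun i => w i ≠ 0)
      fun i _ h h0 => h (by rw [h0, Matrix.zero_vecMulVec])]
    exact Finset.sum_subtype _ (by simp) _
  -- The weights `‖wᵢ‖² / a` undo the normalization; they sum to one since `∑ ‖wᵢ‖² = trace X = a`.
  refine ⟨_, fun j => ‖x (e.symm j)‖⁻¹ • x (e.symm j),
    Finsupp.equivFunOnFinite.symm fun j => a⁻¹ * ‖x (e.symm j)‖ ^ 2, fun j => ⟨?_, ?_, ?_⟩,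
    fun j => ?_, ?_, ?_⟩
  · rw [norm_smul, norm_inv, norm_norm, inv_mul_cancel₀ (hx _)]
  · rw [WithLp.ofLp_smul, Matrix.mulVec_smul, hNw, smul_comm]
  · obtain ⟨i, hi⟩ := hw (e.symm j)
    exact ⟨i, fun p hp => by simp [x, hi p hp]⟩
  · simp only [Finsupp.equivFunOnFinite_symm_apply_apply]
    positivity
  · rw [Finsupp.sum_fintype _ _ (by simp)]
    simp only [Finsupp.equivFunOnFinite_symm_apply_apply]
    rw [e.symm.sum_comp (fun i => a⁻¹ * ‖x i‖ ^ 2), ← Finset.mul_sum]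
    have htr := hctp.2 X hX.1 hX.2.1
    rw [hXκ, Matrix.trace_sum] at htr
    simp only [Matrix.trace_vecMulVec, ← hxsq] at htr
    rw [htr, inv_mul_cancel₀ ha.ne']
  · rw [rankOneSum_eq_sum, hXκ]
    simp only [Finsupp.equivFunOnFinite_symm_apply_apply]
    rw [e.symm.sum_comp (fun i => (a⁻¹ * ‖x i‖ ^ 2) •
      Matrix.vecMulVec (‖x i‖⁻¹ • x i).ofLp (‖x i‖⁻¹ • x i).ofLp), Finset.smul_sum]
    refine Finset.sum_congr rfl fun i _ => ?_
    rw [WithLp.ofLp_smul, Matrix.smul_vecMulVec, Matrix.vecMulVec_smul, smul_smul, smul_smul,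
      smul_smul]
    have hone : a * (a⁻¹ * ‖x i‖ ^ 2) * ‖x i‖⁻¹ * ‖x i‖⁻¹ = 1 := by
      have := hx i
      field_simp
    rw [hone, one_smul]

/-! ### The quadratic program. -/

lemma qpObjective_eq_zero_iff {a : ℝ} {ι : Type} {u : ι → EuclideanSpace ℝ (Idx sz)}
    {ξ : ι →₀ ℝ} : P.qpObjective a u ξ = 0 ↔ P.op (a • rankOneSum u ξ) = P.b := by
  rw [P.op_smul, eq_comm (b := P.b), ← sub_eq_zero (a := P.b)]
  simp [qpObjective]

lemma qpObjective_nonneg (a : ℝ) {ι : Type} (u : ι → EuclideanSpace ℝ (Idx sz)) (ξ : ι →₀ ℝ) :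
    0 ≤ P.qpObjective a u ξ := by
  unfold qpObjective
  positivity

lemma isQPSolution_of_eq_zero {a : ℝ} {ι : Type} {u : ι → EuclideanSpace ℝ (Idx sz)}
    {ξ : ι →₀ ℝ} (h0 : ∀ i, 0 ≤ ξ i) (h1 : (ξ.sum fun _ t => t) = 1)
    (h : P.qpObjective a u ξ = 0) : P.IsQPSolution a u ξ :=
  ⟨⟨h0, h1⟩, fun η _ _ => h ▸ P.qpObjective_nonneg a u η⟩

/-- When the quadratic program has optimal value zero, its solutions yield primal feasible matrices
whose objective value is `φ(z)`. -/
lemma IsQPSolution.mem_primalFeasible {a : ℝ} (hctp : P.CTP a) {z : EuclideanSpace ℝ (Fin m)}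
    {ι : Type} {u : ι → EuclideanSpace ℝ (Idx sz)} (hu : ∀ i, u i ∈ P.topEigenvectors z)
    {η ξ : ι →₀ ℝ} (hη : P.IsQPSolution a u η) (hη0 : P.qpObjective a u η = 0)
    (hξ : P.IsQPSolution a u ξ) :
    a • rankOneSum u ξ ∈ P.primalFeasible ∧
      frob (P.C : Matrix (Idx sz) (Idx sz) ℝ) (a • rankOneSum u ξ) = P.phi a z := by
  have hobj : P.qpObjective a u ξ = 0 :=
    le_antisymm (hη0 ▸ hξ.2 η hη.1.1 hη.1.2) (P.qpObjective_nonneg a u ξ)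
  have hop := P.qpObjective_eq_zero_iff.1 hobj
  have hmem : a • rankOneSum u ξ ∈ blockSym sz :=
    Submodule.smul_mem _ _ (Submodule.sum_mem _ fun i _ => Submodule.smul_mem _ _
      (vecMulVec_mem_blockSym (hu i).2.2))
  refine ⟨⟨hmem, hop, ?_⟩, ?_⟩
  · refine Matrix.PosSemidef.smul (Matrix.posSemidef_sum _ fun i _ => ?_) hctp.1.le
    exact (posSemidef_vecMulVec _).smul (hξ.1.1 i)
  · have h := P.phi_sub_frob hctp z hmem hop
    -- Every `u i` lies in the kernel of `N(z)`, so the gap is zero.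
    have h0 : frob (lambdaMax ((P.C : Matrix (Idx sz) (Idx sz) ℝ) - P.adj z) • 1
        - ((P.C : Matrix (Idx sz) (Idx sz) ℝ) - P.adj z)) (a • rankOneSum u ξ) = 0 := by
      rw [frob_smul_right, rankOneSum, Finsupp.sum, frob_sum_right]
      refine mul_eq_zero_of_right _ (Finset.sum_eq_zero fun i _ => ?_)
      rw [frob_smul_right, frob_vecMulVec, Matrix.sub_mulVec, Matrix.smul_mulVec,
        Matrix.one_mulVec, (hu i).2.1, sub_self, dotProduct_zero, mul_zero]
    linarith

/-- A continuous function attains its minimum on the compact simplex, which is nonempty because `1 ≤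
r`. -/
lemma exists_isQPSolution (a : ℝ) {r : ℕ} (hr : 1 ≤ r)
    (u : Fin r → EuclideanSpace ℝ (Idx sz)) : ∃ ξ, P.IsQPSolution a u ξ := by
  let f : (Fin r → ℝ) → ℝ := fun ξ => P.qpObjective a u (Finsupp.equivFunOnFinite.symm ξ)
  have hf : Continuous f := by
    have h : Continuous fun ξ : Fin r → ℝ => rankOneSum u (Finsupp.equivFunOnFinite.symm ξ) := by
      simp only [rankOneSum_eq_sum, Finsupp.equivFunOnFinite_symm_apply_apply]
      fun_prop
    have := P.continuous_op.comp h
    exact continuous_const.mul ((continuous_const.sub (this.const_smul a)).norm.pow 2)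
  have hne : (stdSimplex ℝ (Fin r)).Nonempty :=
    ⟨_, single_mem_stdSimplex ℝ (⟨0, hr⟩ : Fin r)⟩
  obtain ⟨ξ, hξ, hmin⟩ := (isCompact_stdSimplex ℝ (Fin r)).exists_isMinOn hne hf.continuousOn
  refine ⟨Finsupp.equivFunOnFinite.symm ξ, ⟨fun i => hξ.1 i, ?_⟩, fun η h0 h1 => ?_⟩
  · rw [Finsupp.sum_fintype _ _ (by simp)]
    exact hξ.2
  · rw [Finsupp.sum_fintype _ _ (by simp)] at h1
    have := hmin (show ⇑η ∈ stdSimplex ℝ (Fin r) from ⟨h0, h1⟩)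
    simpa [f] using this

end SDP

end SpectralSDP

/-! ### Assembly of the main theorem. -/

theorem mainTheorem12 {l : ℕ} (hl : 1 ≤ l) (sz : Fin l → ℕ) (hsz : ∀ j, 1 ≤ sz j) {m : ℕ}
    (P : SpectralSDP.SDP sz m) (τ a : ℝ) (hdual : P.StrongDuality τ) (hctp : P.CTP a)
    (T : SpectralSDP.Method) (hT : T.GloballyConvergent (P.phi a)) :
    -- the output value is well defined
    (IsGLB (Set.range (P.phi a)) (-τ) ∧
      ∀ z₀, Filter.Tendsto (fun k => P.phi a (T m (P.phi a) z₀ k)) Filter.atTop (nhds (-τ)) ∧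
        ∀ z, MapClusterPt z Filter.atTop (T m (P.phi a) z₀) →
          SpectralSDP.IsMinimizer (P.phi a) z) ∧
    -- under dual attainability the minimizer exists and the output matrix is well defined
    (P.DualAttained →
      (∃ z, SpectralSDP.IsMinimizer (P.phi a) z) ∧
      ∀ z, SpectralSDP.IsMinimizer (P.phi a) z →
        -- with all unit eigenvectors
        (∀ (ι : Type) (u : ι → EuclideanSpace ℝ (SpectralSDP.Idx sz)),
          P.ListsTopEigenvectors z u →
            (∃ ξ, P.IsQPSolution a u ξ) ∧
            ∀ ξ, P.IsQPSolution a u ξ →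
              P.IsPrimalSolution (a • SpectralSDP.rankOneSum u ξ) ∧
              SpectralSDP.frob (P.C : Matrix _ _ ℝ) (a • SpectralSDP.rankOneSum u ξ) = -τ) ∧
        -- the quadratic program over any finite nonempty family of them is solvable
        (∀ (r : ℕ) (u : Fin r → EuclideanSpace ℝ (SpectralSDP.Idx sz)), 1 ≤ r →
          (∀ j, u j ∈ P.topEigenvectors z) → ∃ ξ, P.IsQPSolution a u ξ) ∧
        -- and some finite family of them suffices
        (∃ (r : ℕ) (u : Fin r → EuclideanSpace ℝ (SpectralSDP.Idx sz)), 1 ≤ r ∧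
          (∀ j, u j ∈ P.topEigenvectors z) ∧
          ∀ ξ, P.IsQPSolution a u ξ →
            P.IsPrimalSolution (a • SpectralSDP.rankOneSum u ξ) ∧
            SpectralSDP.frob (P.C : Matrix _ _ ℝ) (a • SpectralSDP.rankOneSum u ξ) = -τ)) := by
  obtain ⟨j₀⟩ : Nonempty (Fin l) := ⟨⟨0, hl⟩⟩
  have : Nonempty (SpectralSDP.Idx sz) := ⟨⟨j₀, ⟨0, hsz j₀⟩⟩⟩
  have hglb := hdual.isGLB_range_phi hctp
  -- The infimum is needed in `EReal`, where global convergence is formulated.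
  have hinf : ⨅ z, ((P.phi a z : ℝ) : EReal) = ((-τ : ℝ) : EReal) := by
    refine le_antisymm ?_ (le_iInf fun z => EReal.coe_le_coe_iff.2 (hglb.1 ⟨z, rfl⟩))
    rw [← hdual.2]
    exact le_iInf₂ fun z hz =>
      (iInf_le _ z).trans (EReal.coe_le_coe_iff.2 (P.phi_le_lin hctp.1 hz))
  refine ⟨⟨hglb, fun z₀ => ?_⟩, fun ⟨z₀, hz₀, hopt⟩ => ⟨⟨z₀, fun w => ?_⟩, fun z hz => ?_⟩⟩
  · have ht : Filter.Tendsto (fun k => P.phi a (T m (P.phi a) z₀ k)) Filter.atTop (nhds (-τ)) := by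
      have h := hT z₀
      rw [hinf] at h
      exact EReal.tendsto_coe.1 h
    exact ⟨ht, fun z hz => P.isMinimizer_of_mapClusterPt hctp.1
      (fun w => hglb.1 ⟨w, rfl⟩) ht hz⟩
  · refine le_trans ?_ (hglb.1 ⟨w, rfl⟩)
    rw [← EReal.coe_le_coe_iff, ← hdual.2]
    exact le_iInf₂ fun y hy =>
      EReal.coe_le_coe_iff.2 ((P.phi_le_lin hctp.1 hz₀).trans (hopt y hy))
  · have hφz : P.phi a z = -τ :=
      le_antisymm (hglb.2 (by rintro _ ⟨w, rfl⟩; exact hz w)) (hglb.1 ⟨z, rfl⟩)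
    obtain ⟨X, hX, hXτ⟩ := hdual.exists_primal_solution hctp
    obtain ⟨r, v, ξ, hv, hξ0, hξ1, hξX⟩ :=
      P.exists_weights_of_frob_eq_phi hctp hX (hXτ.trans hφz.symm)
    -- One family of top eigenvectors able to represent the fixed primal solution `X` is enough;
    -- this serves both the full list and the finite family `v`.
    have key : ∀ {ι : Type} {u : ι → EuclideanSpace ℝ (SpectralSDP.Idx sz)} {η : ι →₀ ℝ},
        (∀ i, u i ∈ P.topEigenvectors z) → (∀ i, 0 ≤ η i) → (η.sum fun _ t => t) = 1 →
        a • SpectralSDP.rankOneSum u η = X →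
        P.IsQPSolution a u η ∧ ∀ ξ, P.IsQPSolution a u ξ →
          P.IsPrimalSolution (a • SpectralSDP.rankOneSum u ξ) ∧
          SpectralSDP.frob (P.C : Matrix _ _ ℝ) (a • SpectralSDP.rankOneSum u ξ) = -τ := by
      intro ι u η hu h0 h1 hηX
      have hobj : P.qpObjective a u η = 0 := P.qpObjective_eq_zero_iff.2 (hηX ▸ hX.2.1)
      have hsol := P.isQPSolution_of_eq_zero h0 h1 hobj
      refine ⟨hsol, fun ξ hξ => ?_⟩
      obtain ⟨hfeas, hval⟩ := hsol.mem_primalFeasible P hctp hu hobj hξ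
      rw [hφz] at hval
      exact ⟨⟨hfeas, fun Y hY => hval ▸ hdual.frob_le hY⟩, hval⟩
    refine ⟨fun ι u hu => ?_, fun r u hr _ => P.exists_isQPSolution a hr u,
      r, v, ?_, hv, (key hv hξ0 hξ1 hξX).2⟩
    -- The weights on `v` are pushed forward to the listed family. Indices with the same image have
    -- their weights added, and a sign change leaves `u uᵀ` unaltered.
    · choose f hf using fun j => hu.2 (v j) (hv j)
      have h0 (i : ι) : 0 ≤ Finsupp.mapDomain f ξ i := by
        rw [Finsupp.mapDomain, Finsupp.sum_apply]
        exact Finset.sum_nonneg fun j _ => by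
          classical
          beta_reduce
          rw [Finsupp.single_apply]
          split_ifs
          exacts [hξ0 j, le_rfl]
      have h1 : ((Finsupp.mapDomain f ξ).sum fun _ t => t) = 1 := by
        rw [Finsupp.sum_mapDomain_index (by simp) (by simp), hξ1]
      have hX' : a • SpectralSDP.rankOneSum u (Finsupp.mapDomain f ξ) = X := by
        rw [← hξX, SpectralSDP.rankOneSum, SpectralSDP.rankOneSum,
          Finsupp.sum_mapDomain_index (by simp) fun _ _ _ => add_smul _ _ _]
        congr 2
        ext j t : 2
        rcases hf j with h | h <;> simp [h]
      exact ⟨⟨_, (key hu.1 h0 h1 hX').1⟩, (key hu.1 h0 h1 hX').2⟩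
    -- Weights on an empty family would sum to zero instead of one.
    · by_contra hr
      obtain rfl : r = 0 := by omega
      simp [Finsupp.sum_fintype] at hξ1
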